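/- Let $k\ge 2$, let $n=4k$, and let $Q_{4k}=\langle t,u \mid t^{2k}=u^4=1,\ t^k=u^2,\ u^{-1}tu=t^{-1}\rangle$ be the generalized quaternion group of order $4k$. Number its elements by $1,\dots,n$, giving $t^i$ the number $i+1$ and $t^iu$ the number $i+2k+1$ for $0\le i\le 2k-1$, and let $H\le \mathrm{Sym}_n$ be the resulting left regular (Cayley) representation of $Q_{4k}$, in which each element acts on $Q_{4k}$ by left multiplication. Let $$S_n(H)=\langle a_1,\dots,a_n \mid a_1a_2\cdots a_n=a_{\sigma(1)}a_{\sigma(2)}\cdots a_{\sigma(n)},\ \sigma\in H\rangle$$ be the monoid with these generators and relations. Then, for every field $K$: 1. the monoid algebra $K[S_n(H)]$ is a domain, i.e. a nonzero ring (not necessarily commutative) without zero divisors; 2. $K[S_n(H)]$ has only trivial units: an element of $K[S_n(H)]$ is a unit if and only if it has the form $c\,s$ with $0\ne c\in K$ and $s$ an invertible element of the monoid $S_n(H)$; 3. the Jacobson radical of $K[S_n(H)]$ is zero. -/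

import Mathlib

/-- The two words that are identified by the defining relations attached to `H ≤ Sym_n`:
`x_1 x_2 ⋯ x_n` and `x_{σ(1)} x_{σ(2)} ⋯ x_{σ(n)}`, for `σ ∈ H`.
The letters are indexed by `Fin n`. -/
def PermRel {n : ℕ} (H : Subgroup (Equiv.Perm (Fin n))) (v w : FreeMonoid (Fin n)) : Prop :=
  ∃ σ ∈ H, v = FreeMonoid.ofList (List.ofFn fun i : Fin n => i) ∧
    w = FreeMonoid.ofList (List.ofFn fun i : Fin n => σ i)

/-- The monoid `S_n(H) = ⟨a_1, …, a_n ∣ a_1 a_2 ⋯ a_n = a_{σ(1)} a_{σ(2)} ⋯ a_{σ(n)}, σ ∈ H⟩`. -/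
abbrev PermMonoid {n : ℕ} (H : Subgroup (Equiv.Perm (Fin n))) : Type :=
  PresentedMonoid (PermRel H)

namespace GenQuaternion

/-- The generator `t`, of order `2k`, of the generalized quaternion group of order `4k`. -/
def t (k : ℕ) : QuaternionGroup k := QuaternionGroup.a 1

/-- The generator `u`, with `u ^ 2 = t ^ k` and `u⁻¹ t u = t⁻¹`, of the generalized quaternion
group of order `4k`. -/
def u (k : ℕ) : QuaternionGroup k := QuaternionGroup.xa 0

/-- The numbering of the elements of the generalized quaternion group: counting positions from
`0`, the element `t ^ i` has position `i` and `t ^ i * u` has position `i + 2k`, for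
`0 ≤ i < 2k`. It is a bijection for `k ≥ 1`, see `label_bijective`. -/
def label (k : ℕ) (j : Fin (4 * k)) : QuaternionGroup k :=
  if (j : ℕ) < 2 * k then t k ^ (j : ℕ) else t k ^ ((j : ℕ) - 2 * k) * u k

theorem label_bijective (k : ℕ) (hk : 1 ≤ k) : Function.Bijective (label k) := by
  have : NeZero k := ⟨by omega⟩
  have hinj : ∀ a b : ℕ, a < 2 * k → b < 2 * k → ((a : ℕ) : ZMod (2 * k)) = b → a = b := by
    intro a b ha hb h
    rw [ZMod.natCast_eq_natCast_iff'] at h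
    rwa [Nat.mod_eq_of_lt ha, Nat.mod_eq_of_lt hb] at h
  rw [Fintype.bijective_iff_injective_and_card]
  refine ⟨?_, by rw [QuaternionGroup.card, Fintype.card_fin]⟩
  intro i j h
  have hi := i.isLt
  have hj := j.isLt
  unfold label t u at h
  apply Fin.ext
  split_ifs at h <;> simp only [QuaternionGroup.a_one_pow, QuaternionGroup.a_mul_xa,
    QuaternionGroup.a.injEq, QuaternionGroup.xa.injEq, zero_sub, neg_inj, reduceCtorEq] at h
  · exact hinj _ _ (by omega) (by omega) h
  · have := hinj _ _ (by omega) (by omega) h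
    omega

/-- The regular representation `H ≤ Sym_n`, `n = 4k`, of the generalized quaternion group of order
`4k`: the permutations of the positions that are left multiplication by some element `g` of the
group. -/
def regularRep (k : ℕ) : Subgroup (Equiv.Perm (Fin (4 * k))) where
  carrier := {σ | ∃ g : QuaternionGroup k, ∀ j, label k (σ j) = g * label k j}
  one_mem' := ⟨1, fun j => by simp⟩
  mul_mem' := by
    rintro σ τ ⟨g, hg⟩ ⟨h, hh⟩
    exact ⟨g * h, fun j => by rw [Equiv.Perm.mul_apply, hg, hh, mul_assoc]⟩
  inv_mem' := by
    rintro σ ⟨g, hg⟩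
    exact ⟨g⁻¹, fun j => by rw [eq_inv_mul_iff_mul_eq, ← hg, ← Equiv.Perm.mul_apply, mul_inv_cancel, Equiv.Perm.one_apply]⟩

end GenQuaternion

/-!
Let `S = S_n(H)` for a permutation group `H` that is regular, such as the regular representation of
the generalized quaternion group, and let `n = N + 1 ≥ 2`. Only regularity is used: for every
letter exactly one of the defining words `a_{σ(1)} ⋯ a_{σ(n)}` ends in it, and exactly one begins
with it.

Fix a letter `e`, and put `x_c = a_c - a_e`. The algebra `A = K[S]` has an augmentation
`ε : A → K[T]` that sends every letter to `T`. Replacing the letters of a word by `e` one at a time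
shows that the kernel of `ε` is spanned by the elements `e ^ i * x_c * v` with `v` a word. If
`w_c c` denotes the defining word that ends in `c`, then the relation `w_c c = w_e e`, expanded in
the same way, reads `e ^ N * x_c = ∑ e ^ i * x_b * (word)` with all `i < N` on the right, since the
last letters `c` and `e` contribute the terms `e ^ N * x_c` and `0`. Hence the kernel of `ε` is
generated, as a right ideal, by the elements `e ^ i * x_c` with `c ≠ e` and `i < N`
(`sub_aeval_mem_foxSpan`). There is exactly one relation for each `c ≠ e`, and it does nothing but
eliminate `e ^ N * x_c`; so these generators are independent (`eq_zero_of_sum_eq_zero`). The proof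
of independence is a representation of `A` by triangular `2 × 2` matrices whose off-diagonal entry
is the vector of Fox derivatives (`letterAction`): the relations hold because left multiplication by
`e` acts on the free right module with these generators by a companion matrix.

So the kernel of `ε` is free as a right ideal, on generators of positive degree, and by symmetry
free as a left ideal. If `f * g = 0` with `f`, `g` nonzero, then `ε f * ε g = 0`, so `ε f = 0` or
`ε g = 0`. In the first case each coefficient of `f` in the right basis also annihilates `g`, and it
has smaller degree than `f`; in the second case the left basis does the same for `g`. By induction
on the sum of the degrees, `A` is a domain (`noZeroDivisors`). Degrees being additive, the units of `A` are the
nonzero scalars; and if `f ≠ 0` lay in the Jacobson radical, then `1 + e * f` would be a unit of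
positive degree.
-/

open Polynomial

universe u

/-- `A` is the `K`-algebra generated by the letters `a c`, `c : X`, subject to the relations that
all the words `w d ++ [d]`, `d : X`, of length `N + 1` have the same value: for every letter there
is one defining word that ends in it. The universal property is stated for algebras in the
universe of `A`. -/
structure LastLetterPresentation (K : Type u) [Field K] {A : Type u} [Ring A] [Algebra K A]
    {X : Type} (a : X → A) (N : ℕ) (w : X → List X) : Prop where
  length_word : ∀ d, (w d).length = N
  adjoin_range : Algebra.adjoin K (Set.range a) = ⊤
  rel : ∀ c d, ((w c).map a).prod * a c = ((w d).map a).prod * a d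
  exists_lift : ∀ (B : Type u) [Ring B] [Algebra K B] (f : X → B),
    (∀ c d, ((w c).map f).prod * f c = ((w d).map f).prod * f d) →
    ∃ φ : A →ₐ[K] B, ∀ c, φ (a c) = f c

namespace LastLetterPresentation

variable {K : Type u} [Field K] {A : Type u} [Ring A] [Algebra K A] {X : Type}

/-! ### Generators of the augmentation ideal -/

section Span

variable (K)

/-- The span of the words of length at most `d`. -/
def wordSpan (a : X → A) (d : ℕ) : Submodule K A :=
  Submodule.span K {x | ∃ v : List X, v.length ≤ d ∧ x = (v.map a).prod}

/-- The span of the elements `a e ^ i * (a c - a e) * v` with `i < N` and `v` a word, of total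
length at most `d`. -/
def foxSpan (a : X → A) (e : X) (N d : ℕ) : Submodule K A :=
  Submodule.span K {x | ∃ (i : ℕ) (c : X) (v : List X), i < N ∧ v.length + i + 1 ≤ d ∧
    x = a e ^ i * (a c - a e) * (v.map a).prod}

variable {K} {a : X → A} {e : X} {N : ℕ} {w : X → List X}

theorem word_mem_wordSpan {v : List X} {d : ℕ} (h : v.length ≤ d) :
    (v.map a).prod ∈ wordSpan K a d :=
  Submodule.subset_span ⟨v, h, rfl⟩

theorem wordSpan_mono {d d' : ℕ} (h : d ≤ d') : wordSpan K a d ≤ wordSpan K a d' :=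
  Submodule.span_mono fun _ ⟨v, hv, hx⟩ => ⟨v, hv.trans h, hx⟩

theorem foxSpan_mono {d d' : ℕ} (h : d ≤ d') : foxSpan K a e N d ≤ foxSpan K a e N d' :=
  Submodule.span_mono fun _ ⟨i, c, v, hi, hv, hx⟩ => ⟨i, c, v, hi, hv.trans h, hx⟩

theorem exists_mem_wordSpan (hA : LastLetterPresentation K a N w) (f : A) :
    ∃ d, f ∈ wordSpan K a d := by
  have hf : f ∈ Algebra.adjoin K (Set.range a) := by rw [hA.adjoin_range]; trivial
  rw [← Subalgebra.mem_toSubmodule, Algebra.adjoin_eq_span] at hf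
  induction hf using Submodule.span_induction with
  | mem x hx =>
    suffices ∃ v : List X, x = (v.map a).prod by
      obtain ⟨v, rfl⟩ := this
      exact ⟨v.length, word_mem_wordSpan le_rfl⟩
    induction hx using Submonoid.closure_induction with
    | mem x hx =>
      obtain ⟨c, rfl⟩ := hx
      exact ⟨[c], by simp⟩
    | one => exact ⟨[], by simp⟩
    | mul x y _ _ hx hy =>
      obtain ⟨v, rfl⟩ := hx
      obtain ⟨v', rfl⟩ := hy
      exact ⟨v ++ v', by simp⟩
  | zero => exact ⟨0, zero_mem _⟩
  | add x y _ _ hx hy =>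
    obtain ⟨d, hd⟩ := hx
    obtain ⟨d', hd'⟩ := hy
    exact ⟨max d d', add_mem (wordSpan_mono (le_max_left _ _) hd)
      (wordSpan_mono (le_max_right _ _) hd')⟩
  | smul r x _ hx =>
    obtain ⟨d, hd⟩ := hx
    exact ⟨d, Submodule.smul_mem _ _ hd⟩

/-- Replacing the letters of `u` by `e` one at a time: the error terms have their factor
`a c - a e` at one of the positions `j, …, j + u.length - 1`, which are less than `N`. -/
theorem pow_mul_word_sub_pow_mem_foxSpan {d : ℕ} (t : List X) :
    ∀ (u : List X) (j : ℕ), j + u.length ≤ N → j + u.length + t.length ≤ d →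
      a e ^ j * ((u.map a).prod - a e ^ u.length) * (t.map a).prod ∈ foxSpan K a e N d
  | [], j, _, _ => by simp
  | c :: v, j, h, h' => by
    simp only [List.length_cons] at h h'
    have hv := pow_mul_word_sub_pow_mem_foxSpan (d := d) t v (j + 1) (by omega) (by omega)
    have hc : a e ^ j * (a c - a e) * ((v ++ t).map a).prod ∈ foxSpan K a e N d :=
      Submodule.subset_span ⟨j, c, v ++ t, by omega,
        by rw [List.length_append]; omega, rfl⟩
    convert add_mem hc hv using 1
    simp only [List.map_append, List.prod_append, List.map_cons, List.prod_cons, List.length_cons,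
      pow_succ (a e) j, pow_succ' (a e) v.length]
    noncomm_ring

/-- The spans of the `a e ^ i * (a c - a e) * v` with `i < N` absorb left multiplication by `a e`:
the exponent `i = N` is lowered by comparing the defining words that end in `c` and in `e`. -/
theorem mul_mem_foxSpan (hA : LastLetterPresentation K a N w) {d : ℕ} {x : A}
    (hx : x ∈ foxSpan K a e N d) : a e * x ∈ foxSpan K a e N (d + 1) := by
  induction hx using Submodule.span_induction with
  | zero => simp
  | add x y _ _ hx hy => rw [mul_add]; exact add_mem hx hy
  | smul r x _ hx => rw [mul_smul_comm]; exact Submodule.smul_mem _ _ hx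
  | mem x hx =>
    obtain ⟨i, c, v, hi, hv, rfl⟩ := hx
    by_cases hi' : i + 1 < N
    · refine Submodule.subset_span ⟨i + 1, c, v, hi', by omega, ?_⟩
      rw [pow_succ']
      noncomm_ring
    · obtain rfl : N = i + 1 := by omega
      have key (b : X) : a e ^ 0 * (((w b).map a).prod - a e ^ (w b).length) *
          ((b :: v).map a).prod ∈ foxSpan K a e (i + 1) (d + 1) :=
        pow_mul_word_sub_pow_mem_foxSpan (b :: v) (w b) 0 (by rw [hA.length_word]; omega)
          (by rw [hA.length_word, List.length_cons]; omega)
      convert sub_mem (key e) (key c) using 1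
      simp only [hA.length_word, List.map_cons, List.prod_cons, pow_zero, one_mul, sub_mul,
        ← mul_assoc, hA.rel c e, mul_sub, pow_succ']
      abel

theorem word_sub_pow_mem_foxSpan (hA : LastLetterPresentation K a N w) (hN : 0 < N) :
    ∀ v : List X, (v.map a).prod - a e ^ v.length ∈ foxSpan K a e N v.length
  | [] => by simp
  | c :: v => by
    have hc : a e ^ 0 * (a c - a e) * (v.map a).prod ∈ foxSpan K a e N (v.length + 1) :=
      Submodule.subset_span ⟨0, c, v, hN, by omega, rfl⟩
    rw [List.map_cons, List.prod_cons, List.length_cons, pow_succ']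
    convert add_mem hc (hA.mul_mem_foxSpan (hA.word_sub_pow_mem_foxSpan hN v)) using 1
    noncomm_ring

theorem sub_aeval_mem_foxSpan (hA : LastLetterPresentation K a N w) (hN : 0 < N)
    {ε : A →ₐ[K] K[X]} (hε : ∀ c, ε (a c) = Polynomial.X) {d : ℕ} {f : A}
    (hf : f ∈ wordSpan K a d) : f - aeval (a e) (ε f) ∈ foxSpan K a e N d := by
  induction hf using Submodule.span_induction with
  | zero => simp
  | add x y _ _ hx hy =>
    convert add_mem hx hy using 1
    simp only [map_add]
    abel
  | smul r x _ hx =>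
    convert Submodule.smul_mem _ r hx using 1
    simp only [map_smul, smul_sub]
  | mem x hx =>
    obtain ⟨v, hv, rfl⟩ := hx
    have : ε (v.map a).prod = Polynomial.X ^ v.length := by
      rw [map_list_prod, List.map_map, List.map_congr_left (g := fun _ => Polynomial.X)
        (by simp [hε]), List.map_const', List.prod_replicate]
    rw [this, map_pow, aeval_X]
    exact foxSpan_mono hv (hA.word_sub_pow_mem_foxSpan hN v)

theorem exists_sum_of_mem_foxSpan [Fintype X] [DecidableEq X] {d : ℕ} {f : A}
    (hf : f ∈ foxSpan K a e N (d + 1)) :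
    ∃ F : X → ℕ → A, (∀ c i, F c i ∈ wordSpan K a d) ∧
      f = ∑ c, ∑ i ∈ Finset.range N, a e ^ i * (a c - a e) * F c i := by
  induction hf using Submodule.span_induction with
  | zero => exact ⟨0, fun _ _ => zero_mem _, by simp⟩
  | add x y _ _ hx hy =>
    obtain ⟨F, hF, rfl⟩ := hx
    obtain ⟨G, hG, rfl⟩ := hy
    exact ⟨F + G, fun c i => add_mem (hF c i) (hG c i), by
      simp [mul_add, Finset.sum_add_distrib]⟩
  | smul r x _ hx =>
    obtain ⟨F, hF, rfl⟩ := hx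
    exact ⟨r • F, fun c i => Submodule.smul_mem _ _ (hF c i), by
      simp [Finset.smul_sum]⟩
  | mem x hx =>
    obtain ⟨i, c, v, hi, hv, rfl⟩ := hx
    refine ⟨Pi.single c (Pi.single i (v.map a).prod), fun c' i' => ?_, ?_⟩
    · by_cases hc : c' = c
      · subst hc
        by_cases hi' : i' = i
        · subst hi'
          simpa using word_mem_wordSpan (by omega)
        · simp [hi']
      · simp [hc]
    · rw [Finset.sum_eq_single c (fun c' _ hc => by simp [hc]) (by simp),
        Finset.sum_eq_single i (fun i' _ hi' => by simp [hi']) (by simp [hi])]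
      simp

end Span

/-! ### Independence of the generators -/

section Free

variable [DecidableEq X]

/-- The element `x` in the slot `(c, j)` of the right `A`-module `X → ℕ → A`, or `0` when `c = e`;
the slot `(c, j)` stands for `a e ^ j * (a c - a e)`. -/
def slot (K : Type u) [Field K] [Algebra K A] (e c : X) (j : ℕ) : A →ₗ[K] (X → ℕ → A) :=
  if c = e then 0 else
    (LinearMap.single K (fun _ : X => ℕ → A) c) ∘ₗ (LinearMap.single K (fun _ : ℕ => A) j)

theorem slot_apply (e c : X) (j : ℕ) (x : A) (b : X) (i : ℕ) :
    slot K e c j x b i = if c ≠ e ∧ b = c ∧ i = j then x else 0 := by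
  unfold slot
  by_cases hc : c = e
  · simp [hc]
  · by_cases hb : b = c
    · subst hb
      simp [hc, Pi.single_apply]
    · simp [hc, hb]

theorem slot_self (e : X) (j : ℕ) : slot K e e j = (0 : A →ₗ[K] (X → ℕ → A)) := by simp [slot]

/-- The Fox derivative of a word `v` that starts at position `j`: the slots of the letters of `v`,
each with the part of `v` to the right of the letter as its coefficient. -/
def wordFox (K : Type u) [Field K] [Algebra K A] (a : X → A) (e : X) :
    ℕ → List X → (A →ₗ[K] (X → ℕ → A))
  | _, [] => 0
  | j, c :: v => slot K e c j ∘ₗ LinearMap.mulLeft K (v.map a).prod + wordFox K a e (j + 1) v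

/-- The expansion of `a e ^ N * (a c - a e)` in the slots `(b, i)` with `i < N`. -/
def topSlot (K : Type u) [Field K] [Algebra K A] (a : X → A) (e : X) (w : X → List X) (c : X) :
    A →ₗ[K] (X → ℕ → A) :=
  wordFox K a e 0 (w e) ∘ₗ LinearMap.mulLeft K (a e) -
    wordFox K a e 0 (w c) ∘ₗ LinearMap.mulLeft K (a c)

variable [Fintype X]

/-- The operator on the slots that stands for left multiplication by `a e`. -/
def companion (K : Type u) [Field K] [Algebra K A] (a : X → A) (e : X) (N : ℕ) (w : X → List X) :
    Module.End K (X → ℕ → A) :=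
  (LinearMap.pi fun c => LinearMap.pi fun i =>
      if 0 < i ∧ i < N then (LinearMap.proj (i - 1) : (ℕ → A) →ₗ[K] A) ∘ₗ
        (LinearMap.proj c : (X → ℕ → A) →ₗ[K] (ℕ → A)) else 0) +
    ∑ c, topSlot K a e w c ∘ₗ (LinearMap.proj (N - 1) : (ℕ → A) →ₗ[K] A) ∘ₗ
      (LinearMap.proj c : (X → ℕ → A) →ₗ[K] (ℕ → A))

/-- The letter `c` acts on pairs, of an element of the slots and an element of `A`, as on the two
entries of the column of a triangular `2 × 2` matrix. -/
def letterAction (K : Type u) [Field K] [Algebra K A] (a : X → A) (e : X) (N : ℕ)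
    (w : X → List X) (c : X) : Module.End K ((X → ℕ → A) × A) :=
  LinearMap.prod (companion K a e N w ∘ₗ LinearMap.fst K _ _ + slot K e c 0 ∘ₗ LinearMap.snd K _ _)
    (LinearMap.mulLeft K (a c) ∘ₗ LinearMap.snd K _ _)

variable {a : X → A} {e : X} {N : ℕ} {w : X → List X}

theorem companion_apply (m : X → ℕ → A) (b : X) (i : ℕ) :
    companion K a e N w m b i = (if 0 < i ∧ i < N then m b (i - 1) else 0) +
      ∑ c, topSlot K a e w c (m c (N - 1)) b i := by
  simp only [companion, LinearMap.add_apply, LinearMap.sum_apply, Pi.add_apply, Finset.sum_apply,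
    LinearMap.pi_apply, LinearMap.comp_apply, LinearMap.proj_apply]
  split_ifs <;> simp

theorem companion_slot {j : ℕ} (hj : j + 1 < N) (c : X) (x : A) :
    companion K a e N w (slot K e c j x) = slot K e c (j + 1) x := by
  ext b i
  rw [companion_apply]
  have h (d : X) : slot K e c j x d (N - 1) = 0 := by
    rw [slot_apply, if_neg]
    omega
  simp only [h, map_zero, Pi.zero_apply, Finset.sum_const_zero, add_zero, slot_apply]
  grind

theorem companion_slot_last (c : X) (x : A) :
    companion K a e N w (slot K e c (N - 1) x) = topSlot K a e w c x := by
  by_cases hc : c = e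
  · subst hc
    simp [slot_self, topSlot]
  ext b i
  rw [companion_apply, Finset.sum_eq_single c, slot_apply, slot_apply]
  · simp only [ne_eq, hc, not_false_eq_true, and_self, if_true]
    rw [add_eq_right]
    grind
  · intro d _ hd
    simp [slot_apply, hd]
  · simp

theorem companion_pow_slot (c : X) (x : A) :
    ∀ j < N, (companion K a e N w ^ j) (slot K e c 0 x) = slot K e c j x
  | 0, _ => rfl
  | j + 1, hj => by
    rw [pow_succ', Module.End.mul_apply, companion_pow_slot c x j (by omega), companion_slot hj]

theorem companion_wordFox (x : A) : ∀ (v : List X) (j : ℕ), j + v.length < N →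
    companion K a e N w (wordFox K a e j v x) = wordFox K a e (j + 1) v x
  | [], _, _ => by simp [wordFox]
  | c :: v, j, h => by
    simp only [List.length_cons] at h
    simp only [wordFox, LinearMap.add_apply, LinearMap.comp_apply, map_add]
    rw [companion_slot (by omega), companion_wordFox x v (j + 1) (by omega)]

theorem letterAction_apply (c : X) (p : (X → ℕ → A) × A) :
    letterAction K a e N w c p = (companion K a e N w p.1 + slot K e c 0 p.2, a c * p.2) := rfl

theorem word_letterAction (p : (X → ℕ → A) × A) : ∀ v : List X, v.length ≤ N →
    (v.map (letterAction K a e N w)).prod p =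
      ((companion K a e N w ^ v.length) p.1 + wordFox K a e 0 v p.2, (v.map a).prod * p.2)
  | [], _ => by simp [wordFox]
  | c :: v, h => by
    simp only [List.length_cons] at h
    rw [List.map_cons, List.prod_cons, Module.End.mul_apply, word_letterAction p v (by omega),
      letterAction_apply]
    have hfox := companion_wordFox (K := K) (a := a) (e := e) (N := N) (w := w) p.2 v 0 (by omega)
    simp only [map_add, hfox, List.length_cons, pow_succ',
      Module.End.mul_apply, List.map_cons, List.prod_cons, mul_assoc, wordFox, zero_add,
      LinearMap.add_apply, LinearMap.comp_apply, LinearMap.mulLeft_apply]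
    congr 1
    abel

theorem letterAction_rel (hA : LastLetterPresentation K a N w) (hN : 0 < N) (c d : X) :
    ((w c).map (letterAction K a e N w)).prod * letterAction K a e N w c =
      ((w d).map (letterAction K a e N w)).prod * letterAction K a e N w d := by
  suffices ∀ c p, (((w c).map (letterAction K a e N w)).prod * letterAction K a e N w c) p =
      ((companion K a e N w ^ N) (companion K a e N w p.1) + wordFox K a e 0 (w e) (a e * p.2),
        ((w e).map a).prod * a e * p.2) from
    LinearMap.ext fun p => by rw [this, this]
  intro c p
  obtain ⟨M, rfl⟩ : ∃ M, N = M + 1 := ⟨N - 1, by omega⟩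
  rw [Module.End.mul_apply, letterAction_apply,
    word_letterAction _ _ (hA.length_word c).le, hA.length_word, ← hA.rel c e]
  simp only [map_add, mul_assoc]
  rw [pow_succ' _ M, Module.End.mul_apply _ _ (slot K e c 0 p.2),
    companion_pow_slot _ _ _ (Nat.lt_succ_self M)]
  have := companion_slot_last (K := K) (a := a) (e := e) (w := w) (N := M + 1) c p.2
  rw [Nat.add_sub_cancel] at this
  rw [this, topSlot]
  simp only [LinearMap.sub_apply, LinearMap.comp_apply, LinearMap.mulLeft_apply]
  congr 1
  abel

/-- The elements `a e ^ i * (a c - a e)` with `c ≠ e` and `i < N` are independent over `A`, acting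
on the right. -/
theorem eq_zero_of_sum_eq_zero (hA : LastLetterPresentation K a N w) (hN : 0 < N)
    {F : X → ℕ → A} (hF : ∑ c, ∑ i ∈ Finset.range N, a e ^ i * (a c - a e) * F c i = 0)
    {c : X} (hc : c ≠ e) {i : ℕ} (hi : i < N) : F c i = 0 := by
  obtain ⟨φ, hφ⟩ := hA.exists_lift (Module.End K ((X → ℕ → A) × A)) (letterAction K a e N w)
    (hA.letterAction_rel hN)
  have hsnd (f : A) : ∀ p, (φ f p).2 = f * p.2 := by
    have hf : f ∈ Algebra.adjoin K (Set.range a) := by rw [hA.adjoin_range]; trivial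
    induction hf using Algebra.adjoin_induction with
    | mem x hx =>
      obtain ⟨b, rfl⟩ := hx
      intro p
      rw [hφ, letterAction_apply]
    | algebraMap r => intro p; simp [Module.algebraMap_end_apply, Algebra.smul_def]
    | add x y _ _ hx hy => intro p; simp [hx, hy, add_mul]
    | mul x y _ _ hx hy => intro p; simp [hx, hy, mul_assoc]
  have hpow (j : ℕ) (p : (X → ℕ → A) × A) :
      (φ (a e ^ j) p).1 = (companion K a e N w ^ j) p.1 := by
    induction j with
    | zero => simp
    | succ j ih =>
      rw [pow_succ', map_mul, Module.End.mul_apply, hφ, letterAction_apply, ih, slot_self,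
        pow_succ', Module.End.mul_apply]
      simp
  have hterm (b : X) (j : ℕ) (hj : j < N) (x : A) :
      (φ (a e ^ j * (a b - a e) * x) (0, 1)).1 = slot K e b j x := by
    rw [map_mul, map_mul, Module.End.mul_apply, Module.End.mul_apply, hpow, map_sub, hφ, hφ,
      LinearMap.sub_apply, letterAction_apply, letterAction_apply, slot_self, hsnd x]
    simp only [mul_one, LinearMap.zero_apply, add_zero, Prod.fst_sub, add_sub_cancel_left]
    exact companion_pow_slot b x j hj
  have h0 : (φ (∑ c, ∑ i ∈ Finset.range N, a e ^ i * (a c - a e) * F c i) (0, 1)).1 c i = 0 := by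
    simp [hF]
  simp only [map_sum, LinearMap.sum_apply, Prod.fst_sum, Finset.sum_apply] at h0
  rw [Finset.sum_congr rfl fun b _ => Finset.sum_congr rfl fun j hj => by
      rw [hterm b j (Finset.mem_range.1 hj), slot_apply],
    Finset.sum_eq_single c (fun b _ hb => by simp [hb.symm]) (by simp),
    Finset.sum_eq_single i (fun j _ hj => by simp [hj.symm]) (by simp [hi])] at h0
  simpa [hc] using h0

end Free

/-! ### Zero divisors, units and the Jacobson radical -/

section Domain

variable {K : Type u} [Field K] {A : Type u} [Ring A] [Algebra K A] {X : Type}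
  {a : X → A} {N : ℕ} {w w' : X → List X}

theorem exists_augmentation (hA : LastLetterPresentation K a N w) :
    ∃ ε : A →ₐ[K] K[X], ∀ c, ε (a c) = Polynomial.X :=
  hA.exists_lift K[X] (fun _ => Polynomial.X) fun c d => by
    simp [hA.length_word]

/-- An annihilator that the augmentation sends to zero can be replaced by one of smaller degree. -/
theorem exists_smaller_left_annihilator [Fintype X] [DecidableEq X] [Nonempty X]
    (hA : LastLetterPresentation K a N w) (hN : 0 < N)
    {ε : A →ₐ[K] K[X]} (hε : ∀ c, ε (a c) = Polynomial.X) {d : ℕ} {f : A}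
    (hf : f ∈ wordSpan K a d) (hf0 : f ≠ 0) (hεf : ε f = 0) :
    ∃ d' < d, ∃ f' ∈ wordSpan K a d', f' ≠ 0 ∧ ∀ g, f * g = 0 → f' * g = 0 := by
  let e : X := Classical.arbitrary X
  have h := hA.sub_aeval_mem_foxSpan (e := e) hN hε hf
  rw [hεf, map_zero, sub_zero] at h
  obtain _ | d := d
  · refine absurd ?_ hf0
    have : foxSpan K a e N 0 = ⊥ := by
      rw [foxSpan, Submodule.span_eq_bot]
      rintro x ⟨i, c, v, _, h, _⟩
      omega
    rwa [this, Submodule.mem_bot] at h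
  obtain ⟨F, hF, rfl⟩ := exists_sum_of_mem_foxSpan h
  obtain ⟨c, hc, i, hi, hFci⟩ : ∃ c, c ≠ e ∧ ∃ i < N, F c i ≠ 0 := by
    by_contra! hcon
    refine hf0 (Finset.sum_eq_zero fun c _ => Finset.sum_eq_zero fun i hi => ?_)
    by_cases hc : c = e
    · simp [hc]
    · rw [hcon c hc i (Finset.mem_range.1 hi), mul_zero]
  refine ⟨d, d.lt_succ_self, F c i, hF c i, hFci, fun g hg => ?_⟩
  refine hA.eq_zero_of_sum_eq_zero hN (F := fun c i => F c i * g) ?_ hc hi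
  rw [← hg, Finset.sum_mul]
  exact Finset.sum_congr rfl fun c _ => by simp only [Finset.sum_mul, mul_assoc]

open MulOpposite in
/-- If for every letter there is also one defining word that begins with it, then the opposite
algebra is presented in the same way by the reversed words. -/
theorem opposite (hA : LastLetterPresentation K a N w) (hw' : ∀ d, (w' d).length = N)
    (h : ∀ {B : Type u} [Ring B] (f : X → B),
      (∀ c d, ((w c).map f).prod * f c = ((w d).map f).prod * f d) ↔
      ∀ c d, f c * ((w' c).map f).prod = f d * ((w' d).map f).prod) :
    LastLetterPresentation K (fun c => op (a c)) N (fun c => (w' c).reverse) where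
  length_word d := by rw [List.length_reverse, hw']
  adjoin_range := by
    rw [eq_top_iff]
    rintro x -
    have hx : x.unop ∈ Algebra.adjoin K (Set.range a) := by rw [hA.adjoin_range]; trivial
    suffices ∀ y ∈ Algebra.adjoin K (Set.range a),
        op y ∈ Algebra.adjoin K (Set.range fun c => op (a c)) from this _ hx
    intro y hy
    induction hy using Algebra.adjoin_induction with
    | mem y hy =>
      obtain ⟨c, rfl⟩ := hy
      exact Algebra.subset_adjoin ⟨c, rfl⟩
    | algebraMap r => exact Subalgebra.algebraMap_mem _ r
    | add x y _ _ hx hy => exact add_mem hx hy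
    | mul x y _ _ hx hy => exact mul_mem hy hx
  rel c d := by
    have (b : X) : (((w' b).reverse.map fun c => op (a c)).prod * op (a b)) =
        op (a b * ((w' b).map a).prod) := by
      rw [op_mul, op_list_prod, List.map_reverse, List.map_map]
      rfl
    rw [this, this, (h a).1 hA.rel c d]
  exists_lift B _ _ f hf := by
    have hrel : ∀ c d, ((w c).map fun c => op (f c)).prod * op (f c) =
        ((w d).map fun c => op (f c)).prod * op (f d) := by
      refine (h fun c => op (f c)).2 fun c d => ?_
      have (b : X) : op (f b) * ((w' b).map fun c => op (f c)).prod =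
          op (((w' b).reverse.map f).prod * f b) := by
        rw [op_mul, op_list_prod, List.map_reverse, List.map_reverse, List.reverse_reverse,
          List.map_map]
        rfl
      rw [this, this, hf c d]
    obtain ⟨φ, hφ⟩ := hA.exists_lift Bᵐᵒᵖ (fun c => op (f c)) hrel
    exact ⟨AlgHom.opComm φ, fun c => congrArg unop (hφ c)⟩

open MulOpposite in
theorem op_mem_wordSpan {d : ℕ} {f : A} :
    op f ∈ wordSpan K (fun c => op (a c)) d ↔ f ∈ wordSpan K a d := by
  have key (v : List X) : op (v.map a).prod = (v.reverse.map fun c => op (a c)).prod := by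
    rw [op_list_prod, List.map_reverse, List.map_map]
    rfl
  constructor <;> intro hf
  · suffices ∀ x ∈ wordSpan K (fun c => op (a c)) d, unop x ∈ wordSpan K a d from this _ hf
    intro x hx
    induction hx using Submodule.span_induction with
    | zero => exact zero_mem _
    | add x y _ _ hx hy => exact add_mem hx hy
    | smul r x _ hx => exact Submodule.smul_mem _ r hx
    | mem x hx =>
      obtain ⟨v, hv, rfl⟩ := hx
      rw [← List.reverse_reverse v, ← key, unop_op]
      exact word_mem_wordSpan (by rwa [List.length_reverse])
  · induction hf using Submodule.span_induction with
    | zero => exact zero_mem _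
    | add x y _ _ hx hy => exact add_mem hx hy
    | smul r x _ hx => exact Submodule.smul_mem _ r hx
    | mem x hx =>
      obtain ⟨v, hv, rfl⟩ := hx
      rw [key]
      exact word_mem_wordSpan (by rwa [List.length_reverse])

open MulOpposite in
theorem noZeroDivisors [Fintype X] [DecidableEq X] [Nonempty X]
    (hA : LastLetterPresentation K a N w)
    (hA' : LastLetterPresentation K (fun c => op (a c)) N w') (hN : 0 < N) :
    NoZeroDivisors A := by
  obtain ⟨ε, hε⟩ := hA.exists_augmentation
  let ε' : Aᵐᵒᵖ →ₐ[K] K[X] := AlgHom.fromOpposite ε fun _ _ => Commute.all _ _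
  have hε' (c : X) : ε' (op (a c)) = Polynomial.X := hε c
  have main : ∀ n d d' : ℕ, d + d' = n → ∀ f ∈ wordSpan K a d, ∀ g ∈ wordSpan K a d',
      f * g = 0 → f = 0 ∨ g = 0 := by
    intro n
    induction n using Nat.strong_induction_on with
    | _ n ih =>
      intro d d' hd f hf g hg hfg
      by_contra! hne
      obtain ⟨hf0, hg0⟩ := hne
      have hεfg : ε f * ε g = 0 := by rw [← map_mul, hfg, map_zero]
      rcases mul_eq_zero.1 hεfg with h | h
      · obtain ⟨b, hb, f', hf', hf'0, H⟩ :=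
          hA.exists_smaller_left_annihilator hN hε hf hf0 h
        exact (ih (b + d') (by omega) b d' rfl f' hf' g hg (H g hfg)).elim hf'0 hg0
      · obtain ⟨b, hb, g', hg', hg'0, H⟩ :=
          hA'.exists_smaller_left_annihilator hN hε' (op_mem_wordSpan.2 hg)
            ((op_ne_zero_iff g).2 hg0) h
        refine (ih (d + b) (by omega) d b rfl f hf g'.unop (op_mem_wordSpan.1 hg') ?_).elim hf0
          ((unop_ne_zero_iff g').2 hg'0)
        have := H (op f) (by rw [← op_mul, hfg, op_zero])
        simpa using congrArg unop this
  refine ⟨fun {f g} hfg => ?_⟩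
  obtain ⟨d, hd⟩ := hA.exists_mem_wordSpan f
  obtain ⟨d', hd'⟩ := hA.exists_mem_wordSpan g
  exact main _ d d' rfl f hd g hd' hfg

/-- The algebra is graded by the length of words; the homomorphism `A → A[T]` that multiplies each
letter by `T` records this. -/
theorem exists_grading (hA : LastLetterPresentation K a N w) :
    ∃ τ : A →ₐ[K] A[X], ∀ c, τ (a c) = C (a c) * Polynomial.X := by
  refine hA.exists_lift A[X] (fun c => C (a c) * Polynomial.X) fun c d => ?_
  have key (v : List X) : (v.map fun c => C (a c) * (Polynomial.X : A[X])).prod =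
      C (v.map a).prod * Polynomial.X ^ v.length := by
    induction v with
    | nil => simp
    | cons c v ih =>
      rw [List.map_cons, List.prod_cons, ih, List.map_cons, List.prod_cons, List.length_cons,
        C_mul, mul_assoc, ← mul_assoc Polynomial.X, X_mul_C, pow_succ']
      simp only [mul_assoc]
  have h (b : X) : C ((w b).map a).prod * Polynomial.X ^ (w b).length * (C (a b) * Polynomial.X) =
      C (((w b).map a).prod * a b) * (Polynomial.X : A[X]) ^ (N + 1) := by
    rw [hA.length_word, mul_assoc, ← mul_assoc (Polynomial.X ^ N), X_pow_mul_C, C_mul, pow_succ]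
    simp only [mul_assoc]
  rw [key, key, h, h, hA.rel c d]

theorem grading_word {τ : A →ₐ[K] A[X]} (hτ : ∀ c, τ (a c) = C (a c) * Polynomial.X)
    (v : List X) : τ (v.map a).prod = C (v.map a).prod * Polynomial.X ^ v.length := by
  induction v with
  | nil => simp
  | cons c v ih =>
    rw [List.map_cons, List.prod_cons, map_mul, hτ, ih, List.length_cons,
      C_mul, mul_assoc, ← mul_assoc Polynomial.X, X_mul_C, pow_succ']
    simp only [mul_assoc]

/-- Setting `T = 1` in the grading gives back the element; its constant coefficient is the component
of degree zero, which is a scalar. -/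
theorem eval_one_grading_and_coeff_zero_mem_range (hA : LastLetterPresentation K a N w)
    {τ : A →ₐ[K] A[X]} (hτ : ∀ c, τ (a c) = C (a c) * Polynomial.X) (f : A) :
    (τ f).eval 1 = f ∧ (τ f).coeff 0 ∈ Set.range (algebraMap K A) := by
  obtain ⟨d, hd⟩ := hA.exists_mem_wordSpan f
  induction hd using Submodule.span_induction with
  | zero => exact ⟨by simp, 0, by simp⟩
  | add x y _ _ hx hy =>
    obtain ⟨hx, r, hr⟩ := hx
    obtain ⟨hy, s, hs⟩ := hy
    exact ⟨by simp [hx, hy], r + s, by simp [hr, hs]⟩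
  | smul r x _ hx =>
    obtain ⟨hx, s, hs⟩ := hx
    exact ⟨by rw [map_smul, eval_smul, hx], r * s, by
      rw [map_smul, coeff_smul, ← hs, map_mul, Algebra.smul_def]⟩
  | mem x hx =>
    obtain ⟨v, -, rfl⟩ := hx
    rw [grading_word hτ]
    refine ⟨by simp [C_mul_X_pow_eq_monomial], ?_⟩
    cases v with
    | nil => exact ⟨1, by simp⟩
    | cons c v => exact ⟨0, by simp [coeff_X_pow]⟩

/-- The elements of degree zero are the scalars. -/
theorem mem_range_of_natDegree_eq_zero (hA : LastLetterPresentation K a N w) {τ : A →ₐ[K] A[X]}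
    (hτ : ∀ c, τ (a c) = C (a c) * Polynomial.X) {f : A} (hf : (τ f).natDegree = 0) :
    f ∈ Set.range (algebraMap K A) := by
  obtain ⟨h1, h0⟩ := hA.eval_one_grading_and_coeff_zero_mem_range hτ f
  rw [eq_C_of_natDegree_eq_zero hf, eval_C] at h1
  rwa [h1] at h0

theorem mem_range_of_isUnit [NoZeroDivisors A] (hA : LastLetterPresentation K a N w) {f : A}
    (hf : IsUnit f) : f ∈ Set.range (algebraMap K A) := by
  obtain ⟨τ, hτ⟩ := hA.exists_grading
  exact hA.mem_range_of_natDegree_eq_zero hτ (natDegree_eq_zero_of_isUnit (hf.map τ))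

theorem nontrivial (hA : LastLetterPresentation K a N w) : Nontrivial A := by
  obtain ⟨ε, -⟩ := hA.exists_augmentation
  exact ε.toRingHom.domain_nontrivial

theorem jacobson_eq_bot [Nonempty X] [NoZeroDivisors A] (hA : LastLetterPresentation K a N w) :
    Ring.jacobson A = ⊥ := by
  obtain ⟨τ, hτ⟩ := hA.exists_grading
  obtain ⟨ε, hε⟩ := hA.exists_augmentation
  have := hA.nontrivial
  have hinj : Function.Injective τ := fun f g h => by
    rw [← (hA.eval_one_grading_and_coeff_zero_mem_range hτ f).1, h,
      (hA.eval_one_grading_and_coeff_zero_mem_range hτ g).1]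
  let e : X := Classical.arbitrary X
  have he : a e ≠ 0 := fun h => Polynomial.X_ne_zero (R := K) (by rw [← hε e, h, map_zero])
  rw [eq_bot_iff]
  intro f hf
  rw [← Ideal.jacobson_bot, Ideal.mem_jacobson_iff] at hf
  obtain ⟨z, hz⟩ := hf (a e)
  -- A left inverse in a domain is a two-sided inverse.
  have hz : z * (a e * f + 1) = 1 := by
    rw [Ideal.mem_bot, sub_eq_zero] at hz
    rw [mul_add, mul_one, ← mul_assoc, hz]
  have hunit : IsUnit (a e * f + 1) := by
    have hz0 : a e * f + 1 ≠ 0 := fun h => by simp [h] at hz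
    refine ⟨⟨a e * f + 1, z, ?_, hz⟩, rfl⟩
    have : ((a e * f + 1) * z - 1) * (a e * f + 1) = 0 := by
      rw [sub_mul, mul_assoc, hz, mul_one, one_mul, sub_self]
    exact sub_eq_zero.1 ((mul_eq_zero.1 this).resolve_right hz0)
  obtain ⟨r, hr⟩ := hA.mem_range_of_isUnit hunit
  have hef : a e * f = algebraMap K A (r - 1) := by
    rw [map_sub, hr, map_one, add_sub_cancel_right]
  by_contra hf0
  rw [Ideal.mem_bot] at hf0
  have hdeg : (τ (a e * f)).natDegree = 0 := by
    rw [hef, AlgHom.commutes, Polynomial.algebraMap_apply, natDegree_C]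
  rw [map_mul, natDegree_mul ((map_ne_zero_iff τ hinj).2 he) ((map_ne_zero_iff τ hinj).2 hf0),
    hτ, natDegree_C_mul_X _ he] at hdeg
  omega

end Domain

end LastLetterPresentation

/-! ### Regular permutation groups -/

namespace PermMonoid

variable {N : ℕ} {M : Type*} [Monoid M]

theorem prod_ofFn_last (f : Fin (N + 1) → M) (σ : Equiv.Perm (Fin (N + 1))) :
    (List.ofFn fun i => f (σ i)).prod =
      ((List.ofFn fun i : Fin N => σ i.castSucc).map f).prod * f (σ (Fin.last N)) := by
  rw [List.ofFn_succ', List.concat_eq_append, List.prod_append, List.prod_singleton, List.map_ofFn]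
  rfl

theorem prod_ofFn_first (f : Fin (N + 1) → M) (σ : Equiv.Perm (Fin (N + 1))) :
    (List.ofFn fun i => f (σ i)).prod =
      f (σ 0) * ((List.ofFn fun i : Fin N => σ i.succ).map f).prod := by
  rw [List.ofFn_succ, List.prod_cons, List.map_ofFn]
  rfl

/-- The defining relations of the permutation monoid, for a choice `s` of one element of `H` for
every letter that exhausts `H`. -/
theorem forall_prod_eq_iff {H : Subgroup (Equiv.Perm (Fin (N + 1)))}
    {s : Fin (N + 1) → Equiv.Perm (Fin (N + 1))} (hs : Set.range s = H) (f : Fin (N + 1) → M) :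
    (∀ c d, (List.ofFn fun i => f (s c i)).prod = (List.ofFn fun i => f (s d i)).prod) ↔
      ∀ σ ∈ H, (List.ofFn fun i => f (σ i)).prod = (List.ofFn f).prod := by
  have hmem (c) : s c ∈ H := by rw [← SetLike.mem_coe, ← hs]; exact ⟨c, rfl⟩
  constructor
  · intro h σ hσ
    rw [← SetLike.mem_coe, ← hs] at hσ
    obtain ⟨c, rfl⟩ := hσ
    obtain ⟨d, hd⟩ : (1 : Equiv.Perm (Fin (N + 1))) ∈ Set.range s := by rw [hs]; exact H.one_mem
    rw [h c d, hd]
    rfl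
  · intro h c d
    rw [h _ (hmem c), h _ (hmem d)]

theorem exists_section {H : Subgroup (Equiv.Perm (Fin (N + 1)))}
    (hH : ∀ i j, ∃! σ, σ ∈ H ∧ σ i = j) (i : Fin (N + 1)) :
    ∃ s : Fin (N + 1) → Equiv.Perm (Fin (N + 1)), Set.range s = H ∧ ∀ c, s c i = c := by
  choose s hs hu using fun j => hH i j
  refine ⟨s, ?_, fun c => (hs c).2⟩
  ext σ
  constructor
  · rintro ⟨c, rfl⟩
    exact (hs c).1
  · intro hσ
    exact ⟨σ i, (hu (σ i) σ ⟨hσ, rfl⟩).symm⟩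

variable (K : Type u) [Field K]

theorem lastLetterPresentation {H : Subgroup (Equiv.Perm (Fin (N + 1)))}
    {s : Fin (N + 1) → Equiv.Perm (Fin (N + 1))} (hs : Set.range s = H)
    (hlast : ∀ c, s c (Fin.last N) = c) :
    LastLetterPresentation K
      (fun c => MonoidAlgebra.of K (PermMonoid H) (PresentedMonoid.of (PermRel H) c)) N
      (fun c => List.ofFn fun i : Fin N => s c i.castSucc) where
  length_word d := by simp
  adjoin_range := by
    rw [eq_top_iff]
    rintro f -
    induction f using MonoidAlgebra.induction_on with
    | of x =>
      have hx : x ∈ Submonoid.closure (Set.range (PresentedMonoid.of (PermRel H))) := by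
        rw [PresentedMonoid.closure_range_of]
        trivial
      induction hx using Submonoid.closure_induction with
      | mem x hx =>
        obtain ⟨c, rfl⟩ := hx
        exact Algebra.subset_adjoin ⟨c, rfl⟩
      | one => rw [map_one]; exact one_mem _
      | mul x y _ _ hx hy => rw [map_mul]; exact mul_mem hx hy
    | add f g hf hg => exact add_mem hf hg
    | smul r f hf => exact Subalgebra.smul_mem _ hf r
  rel := by
    intro c d
    have h := (forall_prod_eq_iff hs (PresentedMonoid.of (PermRel H))).2 (fun σ hσ => by
      have := PresentedMonoid.mk_eq_mk_of_rel (rels := PermRel H) ⟨σ, hσ, rfl, rfl⟩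
      have hmk (l : List (Fin (N + 1))) : PresentedMonoid.mk (PermRel H) (FreeMonoid.ofList l) =
          (l.map (PresentedMonoid.of (PermRel H))).prod := by
        induction l with
        | nil => exact map_one _
        | cons c l ih => rw [FreeMonoid.ofList_cons, map_mul, ih]; rfl
      rw [hmk, hmk, List.map_ofFn, List.map_ofFn] at this
      exact this.symm) c d
    rw [prod_ofFn_last, prod_ofFn_last, hlast, hlast] at h
    have := congrArg (MonoidAlgebra.of K (PermMonoid H)) h
    rw [map_mul, map_mul, map_list_prod, map_list_prod, List.map_map, List.map_map] at this
    exact this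
  exists_lift B _ _ f hf := by
    have h := (forall_prod_eq_iff hs f).1 fun c d => by
      rw [prod_ofFn_last, prod_ofFn_last, hlast, hlast]
      exact hf c d
    refine ⟨MonoidAlgebra.lift K B _ (PresentedMonoid.lift f ?_), fun c => ?_⟩
    · rintro v w ⟨σ, hσ, rfl, rfl⟩
      rw [FreeMonoid.lift_ofList, FreeMonoid.lift_ofList, List.map_ofFn, List.map_ofFn]
      exact (h σ hσ).symm
    · rw [MonoidAlgebra.lift_of, PresentedMonoid.lift_of]

/-- The monoid algebra of the permutation monoid of a regular permutation group is a domain with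
trivial units and zero Jacobson radical. -/
theorem monoidAlgebra_of_regular {n : ℕ} (hn : 2 ≤ n) {H : Subgroup (Equiv.Perm (Fin n))}
    (hH : ∀ i j, ∃! σ, σ ∈ H ∧ σ i = j) :
    IsDomain (MonoidAlgebra K (PermMonoid H)) ∧
    (∀ f : MonoidAlgebra K (PermMonoid H),
      IsUnit f ↔ ∃ (c : K) (s : PermMonoid H),
        c ≠ 0 ∧ IsUnit s ∧ f = MonoidAlgebra.single s c) ∧
    Ring.jacobson (MonoidAlgebra K (PermMonoid H)) = ⊥ := by
  obtain ⟨N, rfl⟩ : ∃ N, n = N + 1 := ⟨n - 1, by omega⟩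
  obtain ⟨s, hs, hlast⟩ := exists_section hH (Fin.last N)
  obtain ⟨s', hs', hfirst⟩ := exists_section hH 0
  have hA := lastLetterPresentation K hs hlast
  have hA' := hA.opposite (w' := fun c => List.ofFn fun i : Fin N => s' c i.succ)
    (fun d => by simp) fun {B} _ f => by
      have h1 := forall_prod_eq_iff hs f
      rw [← forall_prod_eq_iff hs' f] at h1
      simpa only [prod_ofFn_last, hlast, prod_ofFn_first f (s' _), hfirst] using h1
  have hdom := hA.noZeroDivisors hA' (by omega)
  have hnt := hA.nontrivial
  refine ⟨NoZeroDivisors.to_isDomain _, fun f => ⟨fun hf => ?_, ?_⟩, hA.jacobson_eq_bot⟩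
  · obtain ⟨r, rfl⟩ := hA.mem_range_of_isUnit hf
    refine ⟨r, 1, ?_, isUnit_one, rfl⟩
    rintro rfl
    rw [map_zero] at hf
    exact not_isUnit_zero hf
  · rintro ⟨c, s, hc, hs, rfl⟩
    have : MonoidAlgebra.single s c = algebraMap K _ c * MonoidAlgebra.of K _ s := by simp
    rw [this]
    exact ((isUnit_iff_ne_zero.2 hc).map _).mul (hs.map _)

end PermMonoid

namespace GenQuaternion

theorem regularRep_regular (k : ℕ) (hk : 1 ≤ k) (i j : Fin (4 * k)) :
    ∃! σ, σ ∈ regularRep k ∧ σ i = j := by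
  let e := Equiv.ofBijective (label k) (label_bijective k hk)
  have he (x : QuaternionGroup k) : label k (e.symm x) = x := e.apply_symm_apply x
  refine ⟨(e.trans (Equiv.mulLeft (label k j * (label k i)⁻¹))).trans e.symm, ⟨?_, ?_⟩, ?_⟩
  · exact ⟨label k j * (label k i)⁻¹, fun l => he _⟩
  · apply (label_bijective k hk).1
    refine (he _).trans ?_
    exact inv_mul_cancel_right _ _
  · rintro σ ⟨⟨g, hg⟩, hσ⟩
    ext1 l
    apply (label_bijective k hk).1
    refine Eq.trans ?_ (he _).symm
    have hi := hg i
    rw [hσ] at hi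
    rw [hg l]
    change _ = label k j * (label k i)⁻¹ * label k l
    rw [hi, mul_inv_cancel_right]

end GenQuaternion

theorem theorem3p2 (K : Type*) [Field K] (k : ℕ) (hk : 2 ≤ k) :
    IsDomain (MonoidAlgebra K (PermMonoid (GenQuaternion.regularRep k))) ∧
    (∀ f : MonoidAlgebra K (PermMonoid (GenQuaternion.regularRep k)),
      IsUnit f ↔ ∃ (c : K) (s : PermMonoid (GenQuaternion.regularRep k)),
        c ≠ 0 ∧ IsUnit s ∧ f = MonoidAlgebra.single s c) ∧
    Ring.jacobson (MonoidAlgebra K (PermMonoid (GenQuaternion.regularRep k))) = ⊥ :=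
  PermMonoid.monoidAlgebra_of_regular K (by omega)
    (GenQuaternion.regularRep_regular k (by omega))
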